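/- Let $\mathcal X\subset\mathbb R^d$ be a compact convex set of Euclidean diameter at most $D$, let $f:\mathcal X\to\mathbb R$ be convex and $G$-Lipschitz, let $x_0\in\mathcal X$, and let $\mathcal X\supseteq S_1\supseteq S_2\supseteq\cdots\supseteq S_T$ ($T\ge 1$) be nonempty closed convex sets. Write $\Pi_A$ for the Euclidean projection onto a nonempty closed convex set $A$, $v_t=\min_{x\in S_t}f(x)$, $X_t^*=\arg\min_{x\in S_t}f(x)$ and $\epsilon_t=1/t^2$. The algorithm Gap-Frugal produces actions $x_1,\dots,x_T$ as follows. Let $F_0=0$. At time $t=1,\dots,T$ put $\hat x_t=\Pi_{S_t}(x_{t-1})$. If $$F_{t-1}+f(\hat x_t)\le t\,v_t+\sum_{\tau=1}^t\epsilon_\tau\qquad\text{or}\qquad f(\hat x_t)-v_t\le\epsilon_t,$$ play $x_t=\hat x_t$; otherwise play $x_t=\Pi_{X_t^*}(x_{t-1})$. Then set $F_t=F_{t-1}+f(x_t)$. The input $(S_t)_{t=1}^T$ is called directional with respect to $f$ if for all $1\le s<t\le T$ and every $y_s\in X_s^*$, the points $y_\tau=\Pi_{S_\tau}(y_{\tau-1})$,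 $\tau=s+1,\dots,t-1$, satisfy $f(y_\tau)\le v_t$ for all $\tau\in\{s+1,\dots,t-1\}$. **Theorem.** There are an absolute constant $C$ and a constant $K=K(d,D,G)$, depending only on $d$, $D$ and $G$, such that for all $\mathcal X$, $f$, $x_0$, $T$ and $(S_t)_{t=1}^T$ as above with $(S_t)_{t=1}^T$ directional with respect to $f$, the actions of Gap-Frugal satisfy $$\sum_{t=1}^T f(x_t)-T\min_{x\in S_T}f(x)\le C,\qquad\text{and, if } T\ge 2,\qquad \sum_{t=1}^T\|x_t-x_{t-1}\|\le K\,(\log T)^2 .$$ -/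

import Mathlib

namespace Cones

/-- The ambient Euclidean space. -/
abbrev E (d : ℕ) : Type := EuclideanSpace ℝ (Fin d)

/-- `p` is a point of `A` closest to `x` in the Euclidean norm. -/
def IsNearest {d : ℕ} (A : Set (E d)) (x p : E d) : Prop :=
  p ∈ A ∧ ∀ q ∈ A, ‖x - p‖ ≤ ‖x - q‖

/-- Euclidean projection of `x` onto `A`. On a nonempty closed convex set it is the unique
closest point, see `isNearest_proj` and `IsNearest.eq_proj`. -/
noncomputable def proj {d : ℕ} (A : Set (E d)) (x : E d) : E d :=
  Classical.epsilon (fun p => IsNearest A x p)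

theorem isNearest_proj {d : ℕ} {A : Set (E d)} (hne : A.Nonempty) (hcl : IsClosed A)
    (x : E d) : IsNearest A x (proj A x) := by
  apply Classical.epsilon_spec (p := fun p => IsNearest A x p)
  obtain ⟨p, hp, hd⟩ := hcl.exists_infDist_eq_dist hne x
  refine ⟨p, hp, fun q hq => ?_⟩
  rw [← dist_eq_norm, ← dist_eq_norm, ← hd]
  exact Metric.infDist_le_dist_of_mem hq

theorem IsNearest.eq_proj {d : ℕ} {A : Set (E d)} (hcl : IsClosed A)
    (hc : Convex ℝ A) {x p : E d} (hp : IsNearest A x p) : p = proj A x := by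
  have hq := isNearest_proj ⟨p, hp.1⟩ hcl x
  generalize proj A x = q at hq
  have hm : (1 / 2 : ℝ) • p + (1 / 2 : ℝ) • q ∈ A :=
    hc hp.1 hq.1 (by norm_num) (by norm_num) (by norm_num)
  have e : ‖x - p‖ = ‖x - q‖ := le_antisymm (hp.2 q hq.1) (hq.2 p hp.1)
  have h1 := hp.2 _ hm
  have hpar := parallelogram_law_with_norm ℝ (x - p) (x - q)
  have e1 : (x - p) + (x - q) = (2 : ℝ) • (x - ((1 / 2 : ℝ) • p + (1 / 2 : ℝ) • q)) := by
    module
  have e2 : (x - p) - (x - q) = q - p := by abel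
  rw [e1, e2, norm_smul, Real.norm_of_nonneg (by norm_num : (0 : ℝ) ≤ 2), ← e] at hpar
  have h0 : ‖q - p‖ = 0 := by
    have := norm_nonneg (q - p)
    have := norm_nonneg (x - p)
    nlinarith
  exact (sub_eq_zero.mp (norm_eq_zero.mp h0)).symm

/-- The set of minimizers of `f` over `A`. -/
def argminSet {d : ℕ} (f : E d → ℝ) (A : Set (E d)) : Set (E d) :=
  {x | x ∈ A ∧ ∀ y ∈ A, f x ≤ f y}

/-- The minimal value of `f` over `A` (an attained minimum whenever `argminSet f A` is nonempty,
see `minVal_eq`). -/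
noncomputable def minVal {d : ℕ} (f : E d → ℝ) (A : Set (E d)) : ℝ :=
  sInf (f '' A)

theorem minVal_eq {d : ℕ} {f : E d → ℝ} {A : Set (E d)} {x : E d} (hx : x ∈ argminSet f A) :
    minVal f A = f x := by
  refine IsLeast.csInf_eq ⟨⟨x, hx.1, rfl⟩, ?_⟩
  rintro _ ⟨y, hy, rfl⟩
  exact hx.2 y hy

/-- The sets `S 1 ⊇ S 2 ⊇ ⋯ ⊇ S T` are nonempty, closed and convex, and `S 1 ⊆ X`.
Other values of `S` play no role. -/
structure IsNestedInput {d : ℕ} (X : Set (E d)) (S : ℕ → Set (E d)) (T : ℕ) : Prop where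
  nonempty : ∀ t, 1 ≤ t → t ≤ T → (S t).Nonempty
  closed : ∀ t, 1 ≤ t → t ≤ T → IsClosed (S t)
  convex : ∀ t, 1 ≤ t → t ≤ T → Convex ℝ (S t)
  first_subset : 1 ≤ T → S 1 ⊆ X
  nested : ∀ t, 1 ≤ t → t + 1 ≤ T → S (t + 1) ⊆ S t

/-- Directional input: for all `1 ≤ s < t ≤ T`, the successive projections
`y s, y (s + 1), …, y (t - 1)` started at any minimizer `y s` of `f` over `S s` satisfy
`f (y τ) ≤ min_{S t} f` for `s < τ < t`. -/
def IsDirectional {d : ℕ} (f : E d → ℝ) (S : ℕ → Set (E d)) (T : ℕ) : Prop :=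
  ∀ s t : ℕ, 1 ≤ s → s < t → t ≤ T →
    ∀ y : ℕ → E d, y s ∈ argminSet f (S s) →
      (∀ τ, s < τ → τ < t → y τ = proj (S τ) (y (τ - 1))) →
        ∀ τ, s < τ → τ < t → f (y τ) ≤ minVal f (S t)

/-- The threshold `ε_t = 1 / t ^ 2`, used for `t ≥ 1`. -/
noncomputable def eps (t : ℕ) : ℝ := 1 / (t : ℝ) ^ 2

/-- The cumulative threshold `ε_1 + ⋯ + ε_t`. -/
noncomputable def cumEps (t : ℕ) : ℝ := ∑ τ ∈ Finset.Icc 1 t, eps τ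

open Classical in
/-- The action chosen by Gap-Frugal at time `t`, from its previous action `xprev` and its
cumulative loss `Fprev` before time `t`, when the set `A` is revealed: the lazy projection if the
cumulative regret condition or the instantaneous gap condition holds, and otherwise a jump to the
nearest minimizer. -/
noncomputable def gapFrugalAction {d : ℕ} (f : E d → ℝ) (A : Set (E d)) (t : ℕ)
    (xprev : E d) (Fprev : ℝ) : E d :=
  if Fprev + f (proj A xprev) ≤ t * minVal f A + cumEps t ∨
      f (proj A xprev) - minVal f A ≤ eps t
  then proj A xprev
  else proj (argminSet f A) xprev

/-- The pair (action `x_t`, cumulative loss `F_t`) of Gap-Frugal after `t` rounds. -/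
noncomputable def gapFrugalState {d : ℕ} (f : E d → ℝ) (S : ℕ → Set (E d)) (x₀ : E d) :
    ℕ → E d × ℝ
  | 0 => (x₀, 0)
  | t + 1 =>
    let prev := gapFrugalState f S x₀ t
    let x := gapFrugalAction f (S (t + 1)) (t + 1) prev.1 prev.2
    (x, prev.2 + f x)

/-- The action `x_t` of Gap-Frugal, with `x_0 = x₀`. -/
noncomputable def gapFrugal {d : ℕ} (f : E d → ℝ) (S : ℕ → Set (E d)) (x₀ : E d) (t : ℕ) : E d :=
  (gapFrugalState f S x₀ t).1

/-- Regret of the actions `x 1, …, x T` on the input `(f, S)` against the best fixed action in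
`S T`. -/
noncomputable def regret {d : ℕ} (f : E d → ℝ) (S : ℕ → Set (E d)) (x : ℕ → E d) (T : ℕ) : ℝ :=
  ∑ t ∈ Finset.Icc 1 T, f (x t) - T * minVal f (S T)

/-- Total movement cost of the actions `x 0, x 1, …, x T`. -/
noncomputable def movementCost {d : ℕ} (x : ℕ → E d) (T : ℕ) : ℝ :=
  ∑ t ∈ Finset.Icc 1 T, ‖x t - x (t - 1)‖

end Cones

namespace Cones

open scoped RealInnerProductSpace

/-! Regret: the invariant `F_t ≤ t v_t + ε_1 + ⋯ + ε_t` survives every round. A jump costs exactly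
`v_t`, a lazy step either satisfies the invariant by its own test or costs at most `v_t + ε_t`, and
`v_t` never decreases (`gapFrugalLoss_succ_le`). Since `∑ 1/t² ≤ 2`, the regret is at most 2.

Movement: between jumps the actions are successive projections onto nested convex sets, hence
self-contracted, and such a sequence has length at most a dimensional constant times its diameter
(`exists_length_bound_of_isSelfContracted`). It remains to count jumps. A jump requires a gap larger
than the slack left in the budget. On directional input, lazy losses after a jump at `s` stay below
the minimum at the next jump `t`, so the slack grows by at least `s (v_t - v_s)` (`slack_add_le`).
If `s` is not the first jump, directionality also bounds its gap by `v_t - v_s`, and `s ≥ 2`, so the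
gaps double (`two_mul_lazyGap_le`). They lie between `1/T²` and `G D`, which leaves `O(log T)` jumps
and so `O(log T)` phases, each of bounded length. -/

theorem IsNearest.inner_le_zero {d : ℕ} {A : Set (E d)} (hc : Convex ℝ A) {x p : E d}
    (hp : IsNearest A x p) {q : E d} (hq : q ∈ A) : inner ℝ (x - p) (q - p) ≤ 0 := by
  have hinf : ‖x - p‖ = ⨅ w : A, ‖x - w‖ := by
    have : Nonempty A := ⟨⟨p, hp.1⟩⟩
    refine le_antisymm (le_ciInf fun w => hp.2 w w.2) ?_
    exact ciInf_le (f := fun w : A => ‖x - w‖) ⟨0, by rintro _ ⟨w, rfl⟩; positivity⟩ ⟨p, hp.1⟩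
  exact (norm_eq_iInf_iff_real_inner_le_zero hc hp.1).1 hinf q hq

/-! ### Length of self-contracted sequences -/

/-- Finitely many unit vectors with pairwise nonnegative inner products lie in a common cone whose
opening depends on the dimension only. -/
theorem exists_inner_ge_of_pairwise_inner_nonneg {d : ℕ} {s : Set (E d)} (hs : s.Finite)
    (h1 : ∀ x ∈ s, ‖x‖ = 1) (h2 : ∀ x ∈ s, ∀ y ∈ s, 0 ≤ ⟪x, y⟫) :
    ∃ v : E d, ‖v‖ ≤ 1 ∧ ∀ x ∈ s, 1 / ((d : ℝ) + 1) ≤ ⟪v, x⟫ := by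
  rcases s.eq_empty_or_nonempty with rfl | hne
  · exact ⟨0, by simp, by simp⟩
  obtain ⟨hv, hmin⟩ := isNearest_proj (hne.convexHull (𝕜 := ℝ)) (hs.isClosed_convexHull ℝ) (0 : E d)
  generalize proj (convexHull ℝ s) 0 = v at hv hmin
  have hball : convexHull ℝ s ⊆ Metric.closedBall 0 1 :=
    convexHull_min (fun x hx => by simp [h1 x hx]) (convex_closedBall _ _)
  refine ⟨v, by simpa using hball hv, fun x hx => ?_⟩
  have hlow : 1 / ((d : ℝ) + 1) ≤ ‖v‖ ^ 2 := by
    -- Carathéodory writes `v` with at most `d + 1` weights. The cross terms are nonnegative, so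
    -- `‖v‖² ≥ ∑ w i ^ 2 ≥ 1 / (d + 1)` by Cauchy–Schwarz.
    obtain ⟨ι, _, z, w, hz, hai, hw, hw1, hsum⟩ := eq_pos_convex_span_of_mem_convexHull hv
    have hcard : (Fintype.card ι : ℝ) ≤ (d : ℝ) + 1 := by
      have h := hai.card_le_finrank_succ
      have h' := Submodule.finrank_le (vectorSpan ℝ (Set.range z))
      rw [finrank_euclideanSpace_fin] at h'
      exact_mod_cast h.trans (Nat.succ_le_succ h')
    have hsq : ∑ i, w i ^ 2 ≤ ‖v‖ ^ 2 := by
      rw [← real_inner_self_eq_norm_sq, ← hsum, sum_inner]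
      refine Finset.sum_le_sum fun i _ => ?_
      rw [inner_sum]
      have hi : w i ^ 2 = ⟪w i • z i, w i • z i⟫ := by
        rw [real_inner_self_eq_norm_sq, norm_smul, h1 _ (hz ⟨i, rfl⟩), mul_one, Real.norm_eq_abs,
          sq_abs]
      rw [hi]
      refine Finset.single_le_sum (f := fun j => ⟪w i • z i, w j • z j⟫) (fun j _ => ?_)
        (Finset.mem_univ i)
      rw [real_inner_smul_left, real_inner_smul_right]
      exact mul_nonneg (hw i).le
        (mul_nonneg (hw j).le (h2 _ (hz ⟨i, rfl⟩) _ (hz ⟨j, rfl⟩)))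
    have hcs := sq_sum_le_card_mul_sum_sq (s := Finset.univ) (f := w)
    rw [hw1, Finset.card_univ] at hcs
    rw [div_le_iff₀ (by positivity)]
    have h0 : 0 ≤ ∑ i, w i ^ 2 := Finset.sum_nonneg fun i _ => sq_nonneg _
    nlinarith [sq_nonneg ‖v‖]
  -- As `v` is the point of the hull nearest to the origin, `⟪v, x⟫ ≥ ‖v‖²` on the hull.
  have := IsNearest.inner_le_zero (convex_convexHull ℝ s) ⟨hv, hmin⟩ (subset_convexHull ℝ s hx)
  rw [zero_sub, inner_neg_left, inner_sub_right, real_inner_self_eq_norm_sq] at this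
  linarith

/-- A finite sequence `x 0, …, x n` is self-contracted if the distance to each of its points
decreases along the sequence up to that point. -/
def IsSelfContracted {d : ℕ} (x : ℕ → E d) (n : ℕ) : Prop :=
  ∀ i j k, i ≤ j → j ≤ k → k ≤ n → ‖x j - x k‖ ≤ ‖x i - x k‖

/-- In the triangle on `x i, x j, x k` the side opposite the earliest point is no longer than the
side from `x i` to the latest one, so the angle at `x i` is not obtuse. -/
theorem IsSelfContracted.inner_nonneg {d : ℕ} {x : ℕ → E d} {n : ℕ} (h : IsSelfContracted x n)
    {i j k : ℕ} (hij : i ≤ j) (hik : i ≤ k) (hj : j ≤ n) (hk : k ≤ n) :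
    0 ≤ ⟪x j - x i, x k - x i⟫ := by
  wlog hjk : j ≤ k generalizing j k
  · rw [real_inner_comm]
    exact this hik hij hk hj (le_of_not_ge hjk)
  have h1 := h i j k hij hjk hk
  have h2 := norm_sub_sq_real (x j - x i) (x k - x i)
  rw [sub_sub_sub_cancel_right] at h2
  rw [norm_sub_rev (x i)] at h1
  nlinarith [norm_nonneg (x j - x k), sq_nonneg ‖x j - x i‖]

theorem IsSelfContracted.norm_step_le {d : ℕ} {x : ℕ → E d} {n : ℕ} (h : IsSelfContracted x n)
    {i j : ℕ} (hij : i + 1 ≤ j) (hj : j ≤ n) : ‖x (i + 1) - x i‖ ≤ 2 * ‖x j - x i‖ := by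
  have h1 := h i (i + 1) j (Nat.le_succ i) hij hj
  have h2 := norm_sub_le_norm_sub_add_norm_sub (x (i + 1)) (x j) (x i)
  rw [norm_sub_rev (x i)] at h1
  linarith

/-- From each point of a self-contracted sequence there is a direction in which all later points
recede, at a rate depending on the dimension only. -/
theorem IsSelfContracted.exists_direction {d : ℕ} {x : ℕ → E d} {n : ℕ}
    (h : IsSelfContracted x n) (i : ℕ) :
    ∃ v : E d, ‖v‖ ≤ 1 ∧ ∀ j, i ≤ j → j ≤ n →
      1 / ((d : ℝ) + 1) * ‖x j - x i‖ ≤ ⟪v, x j - x i⟫ := by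
  let σ : ℕ → E d := fun j => ‖x j - x i‖⁻¹ • (x j - x i)
  obtain ⟨v, hv, hv'⟩ := exists_inner_ge_of_pairwise_inner_nonneg
    (s := σ '' {j | (i ≤ j ∧ j ≤ n) ∧ x j ≠ x i})
    (((Set.finite_Iic n).subset fun j hj => hj.1.2).image σ)
    (by
      rintro _ ⟨j, hj, rfl⟩
      have : ‖x j - x i‖ ≠ 0 := norm_ne_zero_iff.2 (sub_ne_zero.2 hj.2)
      simp only [σ, norm_smul, norm_inv, norm_norm]
      exact inv_mul_cancel₀ this)
    (by
      rintro _ ⟨j, hj, rfl⟩ _ ⟨k, hk, rfl⟩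
      simp only [σ, real_inner_smul_left, real_inner_smul_right]
      have := h.inner_nonneg hj.1.1 hk.1.1 hj.1.2 hk.1.2
      positivity)
  refine ⟨v, hv, fun j hij hj => ?_⟩
  by_cases hx : x j = x i
  · simp [hx]
  have h0 : 0 < ‖x j - x i‖ := norm_pos_iff.2 (sub_ne_zero.2 hx)
  have h1 := hv' _ ⟨j, ⟨⟨hij, hj⟩, hx⟩, rfl⟩
  simp only [σ, real_inner_smul_right] at h1
  rwa [inv_mul_eq_div, le_div_iff₀ h0] at h1

/-- A self-contracted sequence has length at most a dimensional constant times its diameter. -/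
theorem exists_length_bound_of_isSelfContracted (d : ℕ) :
    ∃ L : ℝ, 0 ≤ L ∧ ∀ (x : ℕ → E d) (n : ℕ) (D : ℝ), IsSelfContracted x n →
      (∀ i j, i ≤ n → j ≤ n → ‖x i - x j‖ ≤ D) →
        ∑ i ∈ Finset.range n, ‖x (i + 1) - x i‖ ≤ L * D := by
  set ρ : ℝ := 1 / (2 * ((d : ℝ) + 1)) with hρ
  have hρ0 : 0 < ρ := by positivity
  have hρ2 : 1 / ((d : ℝ) + 1) = 2 * ρ := by rw [hρ]; field_simp
  obtain ⟨U, hUb, hUf, hU⟩ := (isCompact_closedBall (0 : E d) 1).finite_cover_balls hρ0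
  lift U to Finset (E d) using hUf
  refine ⟨U.card * (2 / ρ), by positivity, fun x n D h hD => ?_⟩
  have hne (t : ℕ) : (Finset.Icc (min t n) n).Nonempty :=
    ⟨n, Finset.mem_Icc.2 ⟨min_le_right _ _, le_rfl⟩⟩
  -- Support function of the tail from time `t`, nonincreasing in `t`; `min t n` keeps the tail
  -- nonempty for every `t`. Each step will be charged to its decrease in one direction of the
  -- finite net `U`.
  let H : ℕ → E d → ℝ := fun t u => (Finset.Icc (min t n) n).sup' (hne t) fun j => ⟪x j, u⟫
  have hmono (t : ℕ) (u : E d) : H (t + 1) u ≤ H t u :=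
    Finset.sup'_mono _ (Finset.Icc_subset_Icc (min_le_min_right n (Nat.le_succ t)) le_rfl) _
  have hstep (t : ℕ) (ht : t < n) :
      ρ / 2 * ‖x (t + 1) - x t‖ ≤ ∑ u ∈ U, (H t u - H (t + 1) u) := by
    obtain ⟨v, hv, hv'⟩ := h.exists_direction t
    -- Later points recede along `v` at rate `2 * ρ`. A net point `u` within `ρ` of `-v` loses at
    -- most `ρ` of this rate, so the tail's support in direction `u` drops by at least `ρ * ‖x j - x
    -- t‖`, where `j` attains the next maximum.
    obtain ⟨u, hu, huv⟩ := Set.mem_iUnion₂.1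
      (hU (show -v ∈ Metric.closedBall 0 1 by simpa using hv))
    refine le_trans ?_ (Finset.single_le_sum
      (f := fun u => H t u - H (t + 1) u) (fun u _ => sub_nonneg.2 (hmono t u)) hu)
    obtain ⟨j, hj, hHj⟩ := Finset.exists_mem_eq_sup' (hne (t + 1)) fun j => ⟪x j, u⟫
    rw [min_eq_left (Nat.succ_le_of_lt ht), Finset.mem_Icc] at hj
    have hHt : ⟪x t, u⟫ ≤ H t u :=
      Finset.le_sup' (fun j => ⟪x j, u⟫) (Finset.mem_Icc.2 ⟨min_le_left _ _, ht.le⟩)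
    have h1 := hv' j (Nat.le_of_succ_le hj.1) hj.2
    have h2 := h.norm_step_le hj.1 hj.2
    have h3 : ⟪u + v, x j - x t⟫ ≤ ρ * ‖x j - x t‖ := by
      refine (real_inner_le_norm _ _).trans (mul_le_mul_of_nonneg_right ?_ (norm_nonneg _))
      rw [Metric.mem_ball, dist_eq_norm] at huv
      rw [← norm_neg, neg_add', sub_eq_add_neg, add_comm]
      simpa [sub_eq_add_neg] using huv.le
    rw [inner_add_left, inner_sub_right u, real_inner_comm (x j), real_inner_comm (x t)] at h3
    rw [hρ2] at h1
    have h4 : H (t + 1) u = ⟪x j, u⟫ := hHj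
    rw [h4]
    nlinarith
  have htot : ∑ u ∈ U, (H 0 u - H n u) ≤ U.card * D := by
    rw [← nsmul_eq_mul]
    refine Finset.sum_le_card_nsmul _ _ _ fun u hu => ?_
    obtain ⟨j, hj, hHj⟩ := Finset.exists_mem_eq_sup' (hne 0) fun j => ⟪x j, u⟫
    have hHn : ⟪x n, u⟫ ≤ H n u :=
      Finset.le_sup' (fun j => ⟪x j, u⟫) (Finset.mem_Icc.2 ⟨min_le_left _ _, le_rfl⟩)
    have hH0 : H 0 u = ⟪x j, u⟫ := hHj
    have hu1 : ‖u‖ ≤ 1 := by simpa using hUb hu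
    have h1 := real_inner_le_norm (x j - x n) u
    have h2 := hD j n (Finset.mem_Icc.1 hj).2 le_rfl
    rw [inner_sub_left] at h1
    nlinarith [norm_nonneg (x j - x n)]
  have hsum : ρ / 2 * ∑ i ∈ Finset.range n, ‖x (i + 1) - x i‖ ≤ U.card * D := by
    rw [Finset.mul_sum]
    refine (Finset.sum_le_sum fun t ht => hstep t (Finset.mem_range.1 ht)).trans ?_
    rw [Finset.sum_comm]
    simpa only [Finset.sum_range_sub'] using htot
  calc ∑ i ∈ Finset.range n, ‖x (i + 1) - x i‖
      = 2 / ρ * (ρ / 2 * ∑ i ∈ Finset.range n, ‖x (i + 1) - x i‖) := by field_simp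
    _ ≤ 2 / ρ * (U.card * D) := by gcongr
    _ = U.card * (2 / ρ) * D := by ring


/-! ### Projection distances and the thresholds -/

theorem IsNearest.norm_sub_le {d : ℕ} {A : Set (E d)} (hc : Convex ℝ A) {x p : E d}
    (hp : IsNearest A x p) {q : E d} (hq : q ∈ A) : ‖p - q‖ ≤ ‖x - q‖ := by
  have h1 := hp.inner_le_zero hc hq
  have h2 := norm_sub_sq_real (x - p) (q - p)
  rw [sub_sub_sub_cancel_right, norm_sub_rev q p] at h2
  refine le_of_sq_le_sq ?_ (norm_nonneg _)
  nlinarith [sq_nonneg ‖x - p‖]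

theorem cumEps_succ (t : ℕ) : cumEps (t + 1) = cumEps t + eps (t + 1) := by
  simp [cumEps, Finset.sum_Icc_succ_top]

theorem eps_nonneg (t : ℕ) : 0 ≤ eps t := by unfold eps; positivity

theorem cumEps_mono : Monotone cumEps :=
  monotone_nat_of_le_succ fun t => by rw [cumEps_succ]; linarith [eps_nonneg (t + 1)]

theorem cumEps_le_two (t : ℕ) : cumEps t ≤ 2 := by
  -- Strengthened so that the induction telescopes.
  have h (t : ℕ) : cumEps (t + 1) ≤ 2 - 1 / ((t : ℝ) + 1) := by
    induction t with
    | zero => norm_num [cumEps, eps]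
    | succ t ih =>
      rw [cumEps_succ]
      refine (add_le_add_left ih _).trans ?_
      simp only [eps]
      push_cast
      have h1 : (0 : ℝ) < (t : ℝ) + 1 := by positivity
      have h2 : (0 : ℝ) < (t : ℝ) + 1 + 1 := by positivity
      have h3 : 1 / ((t : ℝ) + 1) - 1 / ((t : ℝ) + 1 + 1) - 1 / ((t : ℝ) + 1 + 1) ^ 2
          = 1 / (((t : ℝ) + 1) * ((t : ℝ) + 1 + 1) ^ 2) := by
        field_simp
        ring
      have h4 : 0 ≤ 1 / (((t : ℝ) + 1) * ((t : ℝ) + 1 + 1) ^ 2) := by positivity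
      linarith
  refine (cumEps_mono (Nat.le_succ t)).trans ((h t).trans ?_)
  have : 0 ≤ 1 / ((t : ℝ) + 1) := by positivity
  linarith

/-! ### Jumps, slack and the regret bound -/

/-- The hypotheses on the input of Gap-Frugal that its analysis uses. -/
structure IsAdmissible {d : ℕ} (X : Set (E d)) (f : E d → ℝ) (S : ℕ → Set (E d)) (x₀ : E d)
    (T : ℕ) (D : ℝ) (G : NNReal) : Prop where
  compact : IsCompact X
  diam_le : Metric.diam X ≤ D
  lipschitz : LipschitzOnWith G f X
  mem : x₀ ∈ X
  input : IsNestedInput X S T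
  directional : IsDirectional f S T

/-- The cumulative loss of Gap-Frugal after `t` rounds. -/
noncomputable def gapFrugalLoss {d : ℕ} (f : E d → ℝ) (S : ℕ → Set (E d)) (x₀ : E d) (t : ℕ) : ℝ :=
  (gapFrugalState f S x₀ t).2

/-- The gap of the lazy projection at time `t`. -/
noncomputable def lazyGap {d : ℕ} (f : E d → ℝ) (S : ℕ → Set (E d)) (x₀ : E d) (t : ℕ) : ℝ :=
  f (proj (S t) (gapFrugal f S x₀ (t - 1))) - minVal f (S t)

/-- Gap-Frugal jumps to a minimizer at time `t`. -/
def IsJump {d : ℕ} (f : E d → ℝ) (S : ℕ → Set (E d)) (x₀ : E d) (t : ℕ) : Prop :=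
  1 ≤ t ∧ t * minVal f (S t) + cumEps t
      < gapFrugalLoss f S x₀ (t - 1) + f (proj (S t) (gapFrugal f S x₀ (t - 1))) ∧
    eps t < lazyGap f S x₀ t

/-- The budget left at time `t` before the loss of time `t` is added. -/
noncomputable def slack {d : ℕ} (f : E d → ℝ) (S : ℕ → Set (E d)) (x₀ : E d) (t : ℕ) : ℝ :=
  ((t : ℝ) - 1) * minVal f (S t) + cumEps t - gapFrugalLoss f S x₀ (t - 1)

section

variable {d : ℕ} {X : Set (E d)} {f : E d → ℝ} {S : ℕ → Set (E d)} {x₀ : E d} {T : ℕ} {D : ℝ}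
  {G : NNReal}

theorem gapFrugalLoss_succ (t : ℕ) : gapFrugalLoss f S x₀ (t + 1)
    = gapFrugalLoss f S x₀ t + f (gapFrugal f S x₀ (t + 1)) := rfl

theorem gapFrugalLoss_eq_sum (t : ℕ) :
    gapFrugalLoss f S x₀ t = ∑ τ ∈ Finset.Icc 1 t, f (gapFrugal f S x₀ τ) := by
  induction t with
  | zero => rfl
  | succ t ih => rw [gapFrugalLoss_succ, ih, Finset.sum_Icc_succ_top (Nat.le_add_left 1 t)]

theorem IsJump.gapFrugal_eq {t : ℕ} (h : IsJump f S x₀ t) :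
    gapFrugal f S x₀ t = proj (argminSet f (S t)) (gapFrugal f S x₀ (t - 1)) := by
  obtain ⟨t, rfl⟩ := Nat.exists_eq_add_of_le' h.1
  exact if_neg (not_or.2 ⟨not_le.2 h.2.1, not_le.2 h.2.2⟩)

theorem gapFrugal_eq_of_not_isJump {t : ℕ} (ht : 1 ≤ t) (h : ¬ IsJump f S x₀ t) :
    gapFrugal f S x₀ t = proj (S t) (gapFrugal f S x₀ (t - 1)) := by
  obtain ⟨t, rfl⟩ := Nat.exists_eq_add_of_le' ht
  refine if_pos ?_
  by_contra hc
  rw [not_or, not_le, not_le] at hc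
  exact h ⟨ht, hc.1, hc.2⟩

/-- This is the failed cumulative test, rearranged. -/
theorem IsJump.slack_lt {t : ℕ} (h : IsJump f S x₀ t) : slack f S x₀ t < lazyGap f S x₀ t := by
  have := h.2.1
  unfold slack lazyGap
  linarith

theorem IsAdmissible.norm_sub_le (h : IsAdmissible X f S x₀ T D G) {x y : E d} (hx : x ∈ X)
    (hy : y ∈ X) : ‖x - y‖ ≤ D := by
  rw [← dist_eq_norm]
  exact (Metric.dist_le_diam_of_mem h.compact.isBounded hx hy).trans h.diam_le

theorem IsAdmissible.subset_of_le (h : IsAdmissible X f S x₀ T D G) {s t : ℕ} (hs : 1 ≤ s)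
    (hst : s ≤ t) (ht : t ≤ T) : S t ⊆ S s := by
  induction t, hst using Nat.le_induction with
  | base => exact subset_rfl
  | succ t hst ih =>
    exact (h.input.nested t (hs.trans hst) ht).trans (ih (Nat.le_of_succ_le ht))

theorem IsAdmissible.subset (h : IsAdmissible X f S x₀ T D G) {t : ℕ} (ht : 1 ≤ t)
    (htT : t ≤ T) : S t ⊆ X :=
  (h.subset_of_le le_rfl ht htT).trans (h.input.first_subset (ht.trans htT))

theorem IsAdmissible.argminSet_nonempty (h : IsAdmissible X f S x₀ T D G) {t : ℕ} (ht : 1 ≤ t)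
    (htT : t ≤ T) : (argminSet f (S t)).Nonempty := by
  obtain ⟨x, hx, hmin⟩ := (h.compact.of_isClosed_subset (h.input.closed t ht htT)
    (h.subset ht htT)).exists_isMinOn (h.input.nonempty t ht htT)
    (h.lipschitz.continuousOn.mono (h.subset ht htT))
  exact ⟨x, hx, fun y hy => hmin hy⟩

theorem IsAdmissible.minVal_le (h : IsAdmissible X f S x₀ T D G) {t : ℕ} (ht : 1 ≤ t)
    (htT : t ≤ T) {x : E d} (hx : x ∈ S t) : minVal f (S t) ≤ f x := by
  obtain ⟨z, hz⟩ := h.argminSet_nonempty ht htT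
  rw [minVal_eq hz]
  exact hz.2 x hx

theorem IsAdmissible.minVal_mono (h : IsAdmissible X f S x₀ T D G) {s t : ℕ} (hs : 1 ≤ s)
    (hst : s ≤ t) (htT : t ≤ T) : minVal f (S s) ≤ minVal f (S t) := by
  obtain ⟨z, hz⟩ := h.argminSet_nonempty (hs.trans hst) htT
  rw [minVal_eq hz]
  exact h.minVal_le hs (hst.trans htT) (h.subset_of_le hs hst htT hz.1)

theorem IsAdmissible.isClosed_argminSet (h : IsAdmissible X f S x₀ T D G) {t : ℕ} (ht : 1 ≤ t)
    (htT : t ≤ T) : IsClosed (argminSet f (S t)) := by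
  have heq : argminSet f (S t) = S t ∩ f ⁻¹' Set.Iic (minVal f (S t)) := by
    ext x
    refine ⟨fun hx => ⟨hx.1, (minVal_eq hx).ge⟩, fun hx => ⟨hx.1, fun y hy => ?_⟩⟩
    exact hx.2.trans (h.minVal_le ht htT hy)
  rw [heq]
  exact (h.lipschitz.continuousOn.mono (h.subset ht htT)).preimage_isClosed_of_isClosed
    (h.input.closed t ht htT) isClosed_Iic

theorem IsAdmissible.isNearest_proj (h : IsAdmissible X f S x₀ T D G) {t : ℕ} (ht : 1 ≤ t)
    (htT : t ≤ T) (x : E d) : IsNearest (S t) x (proj (S t) x) :=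
  Cones.isNearest_proj (h.input.nonempty t ht htT) (h.input.closed t ht htT) x

theorem IsAdmissible.gapFrugal_mem_argminSet (h : IsAdmissible X f S x₀ T D G) {t : ℕ}
    (htT : t ≤ T) (hj : IsJump f S x₀ t) : gapFrugal f S x₀ t ∈ argminSet f (S t) := by
  rw [hj.gapFrugal_eq]
  exact (Cones.isNearest_proj (h.argminSet_nonempty hj.1 htT) (h.isClosed_argminSet hj.1 htT) _).1

theorem IsAdmissible.gapFrugal_mem (h : IsAdmissible X f S x₀ T D G) {t : ℕ} (ht : 1 ≤ t)
    (htT : t ≤ T) : gapFrugal f S x₀ t ∈ S t := by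
  by_cases hj : IsJump f S x₀ t
  · exact (h.gapFrugal_mem_argminSet htT hj).1
  · rw [gapFrugal_eq_of_not_isJump ht hj]
    exact (h.isNearest_proj ht htT _).1

theorem IsAdmissible.gapFrugal_mem_domain (h : IsAdmissible X f S x₀ T D G) {t : ℕ}
    (htT : t ≤ T) : gapFrugal f S x₀ t ∈ X := by
  rcases Nat.eq_zero_or_pos t with rfl | ht
  · exact h.mem
  · exact h.subset ht htT (h.gapFrugal_mem ht htT)

theorem IsAdmissible.diam_nonneg (h : IsAdmissible X f S x₀ T D G) : 0 ≤ D :=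
  Metric.diam_nonneg.trans h.diam_le

theorem IsAdmissible.lazyGap_le (h : IsAdmissible X f S x₀ T D G) {t : ℕ} (ht : 1 ≤ t)
    (htT : t ≤ T) : lazyGap f S x₀ t ≤ G * D := by
  obtain ⟨z, hz⟩ := h.argminSet_nonempty ht htT
  have hp := h.subset ht htT (h.isNearest_proj ht htT (gapFrugal f S x₀ (t - 1))).1
  have hzX := h.subset ht htT hz.1
  unfold lazyGap
  rw [minVal_eq hz]
  refine (le_abs_self _).trans ?_
  rw [← Real.dist_eq]
  refine (h.lipschitz.dist_le_mul _ hp _ hzX).trans ?_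
  rw [dist_eq_norm]
  exact mul_le_mul_of_nonneg_left (h.norm_sub_le hp hzX) G.2

/-- A jump adds exactly the minimum. A lazy step violating the conclusion would fail the cumulative
test and, given `hF`, also the gap test, so it would have been a jump. -/
theorem IsAdmissible.gapFrugalLoss_succ_le (h : IsAdmissible X f S x₀ T D G) {t : ℕ}
    (htT : t + 1 ≤ T) (hF : gapFrugalLoss f S x₀ t ≤ t * minVal f (S (t + 1)) + cumEps t) :
    gapFrugalLoss f S x₀ (t + 1) ≤ (t + 1 : ℕ) * minVal f (S (t + 1)) + cumEps (t + 1) := by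
  by_cases hj : IsJump f S x₀ (t + 1)
  · have hv := minVal_eq (h.gapFrugal_mem_argminSet htT hj)
    rw [gapFrugalLoss_succ, cumEps_succ, ← hv]
    push_cast
    linarith [eps_nonneg (t + 1)]
  · have hx := gapFrugal_eq_of_not_isJump (Nat.le_add_left 1 t) hj
    rw [gapFrugalLoss_succ, hx]
    by_contra hc
    rw [not_le] at hc
    refine hj ⟨Nat.le_add_left 1 t, hc, ?_⟩
    rw [cumEps_succ] at hc
    unfold lazyGap
    rw [Nat.add_sub_cancel]
    push_cast at hc
    linarith

/-- The budget of the previous round carries over because minima increase as the sets shrink. -/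
theorem IsAdmissible.gapFrugalLoss_le_next (h : IsAdmissible X f S x₀ T D G) {t : ℕ}
    (htT : t + 1 ≤ T) : gapFrugalLoss f S x₀ t ≤ t * minVal f (S (t + 1)) + cumEps t := by
  induction t with
  | zero => simp [cumEps, gapFrugalLoss, gapFrugalState]
  | succ t ih =>
    have h1 := h.gapFrugalLoss_succ_le (Nat.le_of_succ_le htT) (ih (Nat.le_of_succ_le htT))
    have h2 := h.minVal_mono (Nat.le_add_left 1 t) (Nat.le_succ (t + 1)) htT
    have h3 := mul_le_mul_of_nonneg_left h2 (Nat.cast_nonneg (α := ℝ) (t + 1))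
    linarith

theorem IsAdmissible.slack_nonneg (h : IsAdmissible X f S x₀ T D G) {t : ℕ} (ht : 1 ≤ t)
    (htT : t ≤ T) : 0 ≤ slack f S x₀ t := by
  obtain ⟨t, rfl⟩ := Nat.exists_eq_add_of_le' ht
  have h1 := h.gapFrugalLoss_le_next htT
  have h2 := cumEps_mono (Nat.le_add_right t 1)
  unfold slack
  rw [Nat.add_sub_cancel]
  push_cast
  linarith

theorem IsAdmissible.regret_le (h : IsAdmissible X f S x₀ T D G) (hT : 1 ≤ T) :
    regret f S (gapFrugal f S x₀) T ≤ 2 := by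
  obtain ⟨t, rfl⟩ := Nat.exists_eq_add_of_le' hT
  have h1 := h.gapFrugalLoss_succ_le le_rfl (h.gapFrugalLoss_le_next le_rfl)
  rw [gapFrugalLoss_eq_sum] at h1
  have h2 := cumEps_le_two (t + 1)
  unfold regret
  linarith

/-! ### Doubling of the gaps -/

/-- On directional input the lazy projections after a jump do not exceed the next minimum, up to
and including the one at which the next jump occurs. -/
theorem IsAdmissible.lazyProj_le (h : IsAdmissible X f S x₀ T D G) {s τ t : ℕ}
    (hs : IsJump f S x₀ s) (hsτ : s < τ) (hτt : τ < t) (htT : t ≤ T)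
    (hno : ∀ i, s < i → i < τ → ¬ IsJump f S x₀ i) :
    f (proj (S τ) (gapFrugal f S x₀ (τ - 1))) ≤ minVal f (S t) := by
  -- Follows the actions up to the jump at `s`, then projects forever. It agrees with the actions
  -- only before `τ`, where a jump is allowed; this is what later bounds the gap at a jump.
  let y : ℕ → E d := fun i => Nat.rec (gapFrugal f S x₀ 0)
    (fun j p => if j + 1 ≤ s then gapFrugal f S x₀ (j + 1) else proj (S (j + 1)) p) i
  have hy1 : ∀ i, i < τ → y i = gapFrugal f S x₀ i := by
    intro i
    induction i with
    | zero => exact fun _ => rfl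
    | succ i ih =>
      intro hi
      by_cases his : i + 1 ≤ s
      · exact if_pos his
      · have : y (i + 1) = proj (S (i + 1)) (y i) := if_neg his
        rw [this, ih (Nat.lt_of_succ_lt hi), gapFrugal_eq_of_not_isJump (Nat.le_add_left 1 i)
          (hno _ (not_le.1 his) hi), Nat.add_sub_cancel]
  have hy2 : ∀ i, s < i → y i = proj (S i) (y (i - 1)) := by
    intro i hi
    obtain ⟨i, rfl⟩ := Nat.exists_eq_add_of_le' (Nat.one_le_of_lt hi)
    exact if_neg (not_le.2 hi)
  have := h.directional s t hs.1 (hsτ.trans hτt) htT y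
    (by
      rw [hy1 s hsτ]
      exact h.gapFrugal_mem_argminSet ((hsτ.trans hτt).le.trans htT) hs)
    (fun i hi _ => hy2 i hi) τ hsτ hτt
  rwa [hy2 τ hsτ, hy1 _ (by omega)] at this

/-- Between consecutive jumps at `s < t` the slack grows by at least `s * (v_t - v_s)`. -/
theorem IsAdmissible.slack_add_le (h : IsAdmissible X f S x₀ T D G) {s t : ℕ}
    (hs : IsJump f S x₀ s) (hst : s < t) (htT : t ≤ T)
    (hno : ∀ i, s < i → i < t → ¬ IsJump f S x₀ i) :
    slack f S x₀ s + s * (minVal f (S t) - minVal f (S s)) ≤ slack f S x₀ t := by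
  have hloss : ∀ k, s + k < t → gapFrugalLoss f S x₀ (s + k)
      ≤ gapFrugalLoss f S x₀ (s - 1) + minVal f (S s) + k * minVal f (S t) := by
    intro k
    induction k with
    | zero =>
      intro _
      obtain ⟨r, rfl⟩ := Nat.exists_eq_add_of_le' hs.1
      rw [minVal_eq (h.gapFrugal_mem_argminSet (hst.le.trans htT) hs), add_zero,
        gapFrugalLoss_succ, Nat.add_sub_cancel]
      simp
    | succ k ih =>
      intro hk
      have h1 := ih (by omega)
      have h2 := h.lazyProj_le hs (τ := s + (k + 1)) (by omega) hk htT
        fun i hi hi' => hno i hi (hi'.trans hk)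
      rw [← gapFrugal_eq_of_not_isJump (by omega) (hno _ (by omega) hk), ← add_assoc] at h2
      rw [← add_assoc, gapFrugalLoss_succ]
      push_cast
      linarith
  obtain ⟨k, rfl⟩ := Nat.exists_eq_add_of_lt hst
  have h1 := hloss k (by omega)
  have h2 := cumEps_mono hst.le
  unfold slack
  rw [Nat.add_sub_cancel]
  push_cast
  linarith

/-- Apart from the first jump, the gaps at the jumps at least double. -/
theorem IsAdmissible.two_mul_lazyGap_le (h : IsAdmissible X f S x₀ T D G) {r s t : ℕ}
    (hr : IsJump f S x₀ r) (hs : IsJump f S x₀ s) (ht : IsJump f S x₀ t) (hrs : r < s)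
    (hst : s < t) (htT : t ≤ T) (hno : ∀ i, r < i → i < s → ¬ IsJump f S x₀ i)
    (hno' : ∀ i, s < i → i < t → ¬ IsJump f S x₀ i) :
    2 * lazyGap f S x₀ s ≤ lazyGap f S x₀ t := by
  have h1 := h.lazyProj_le hr hrs hst htT hno
  have h2 := h.slack_add_le hs hst htT hno'
  have h3 := h.slack_nonneg hs.1 (hst.le.trans htT)
  have h4 := ht.slack_lt
  -- The earlier jump `r ≥ 1` forces `s ≥ 2`: this is the doubling factor.
  have h5 : (2 : ℝ) ≤ s := by exact_mod_cast (Nat.succ_le_succ hr.1).trans hrs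
  have h6 : lazyGap f S x₀ s ≤ minVal f (S t) - minVal f (S s) := by
    unfold lazyGap
    linarith
  have h7 : 0 ≤ lazyGap f S x₀ s := (eps_nonneg s).trans hs.2.2.le
  nlinarith

/-! ### Counting the jumps -/

open Classical in
/-- The number of jumps up to time `t`. -/
noncomputable def jumpCount {d : ℕ} (f : E d → ℝ) (S : ℕ → Set (E d)) (x₀ : E d) (t : ℕ) : ℕ :=
  ((Finset.Icc 1 t).filter (IsJump f S x₀)).card

theorem jumpCount_succ_of_isJump {t : ℕ} (h : IsJump f S x₀ (t + 1)) :
    jumpCount f S x₀ (t + 1) = jumpCount f S x₀ t + 1 := by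
  classical
  unfold jumpCount
  rw [← Finset.insert_Icc_right_eq_Icc_add_one (Nat.le_add_left 1 t),
    Finset.filter_insert, if_pos h,
    Finset.card_insert_of_notMem (by simp)]

theorem jumpCount_succ_of_not_isJump {t : ℕ} (h : ¬ IsJump f S x₀ (t + 1)) :
    jumpCount f S x₀ (t + 1) = jumpCount f S x₀ t := by
  classical
  unfold jumpCount
  rw [← Finset.insert_Icc_right_eq_Icc_add_one (Nat.le_add_left 1 t),
    Finset.filter_insert, if_neg h]

/-- Either there is no jump up to time `t`, or there is a last one. -/
theorem exists_last_jump (f : E d → ℝ) (S : ℕ → Set (E d)) (x₀ : E d) (t : ℕ) :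
    (jumpCount f S x₀ t = 0 ∧ ∀ i, i ≤ t → ¬ IsJump f S x₀ i) ∨
      ∃ s ≤ t, IsJump f S x₀ s ∧ jumpCount f S x₀ s = jumpCount f S x₀ t ∧
        ∀ i, s < i → i ≤ t → ¬ IsJump f S x₀ i := by
  induction t with
  | zero =>
    refine Or.inl ⟨by simp [jumpCount], fun i hi hj => ?_⟩
    have := hj.1
    omega
  | succ t ih =>
    by_cases hj : IsJump f S x₀ (t + 1)
    · exact Or.inr ⟨t + 1, le_rfl, hj, rfl, fun i hi hi' => absurd hi' (not_le.2 hi)⟩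
    · rw [jumpCount_succ_of_not_isJump hj]
      rcases ih with ⟨h0, hno⟩ | ⟨s, hst, hs, hc, hno⟩
      · refine Or.inl ⟨h0, fun i hi => ?_⟩
        rcases Nat.le_succ_iff.1 hi with hi | rfl
        exacts [hno i hi, hj]
      · refine Or.inr ⟨s, Nat.le_succ_of_le hst, hs, hc, fun i hi hi' => ?_⟩
        rcases Nat.le_succ_iff.1 hi' with hi' | rfl
        exacts [hno i hi hi', hj]

/-- Doubling starts at the second jump, whose gap exceeds `eps t ≥ 1 / T ^ 2`; hence the offset 2.
-/
theorem IsAdmissible.two_pow_mul_le_lazyGap (h : IsAdmissible X f S x₀ T D G) (k : ℕ) {t : ℕ}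
    (ht : IsJump f S x₀ t) (htT : t ≤ T) (hk : jumpCount f S x₀ t = k + 2) :
    2 ^ k * (1 / (T : ℝ) ^ 2) ≤ lazyGap f S x₀ t := by
  induction k generalizing t with
  | zero =>
    refine le_trans ?_ ht.2.2.le
    have : (0 : ℝ) < t := by exact_mod_cast ht.1
    rw [pow_zero, one_mul]
    unfold eps
    gcongr
  | succ k ih =>
    obtain ⟨t, rfl⟩ := Nat.exists_eq_add_of_le' ht.1
    rw [jumpCount_succ_of_isJump ht] at hk
    obtain ⟨h0, -⟩ | ⟨s, hst, hs, hc, hno⟩ := exists_last_jump f S x₀ t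
    · omega
    obtain ⟨s, rfl⟩ := Nat.exists_eq_add_of_le' hs.1
    have hc' := jumpCount_succ_of_isJump hs
    obtain ⟨h0, -⟩ | ⟨r, hrs, hr, -, hno'⟩ := exists_last_jump f S x₀ s
    · omega
    have h1 := ih hs (by omega) (by omega)
    have h2 := h.two_mul_lazyGap_le hr hs ht (by omega) (by omega) htT
      (fun i hi hi' => hno' i hi (by omega)) (fun i hi hi' => hno i hi (by omega))
    rw [pow_succ]
    linarith

/-- The doubled gaps cannot exceed `G * D`; the maximum with 1 keeps the logarithm nonnegative. -/
theorem IsAdmissible.jumpCount_le (h : IsAdmissible X f S x₀ T D G) (hT : 1 ≤ T) :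
    (jumpCount f S x₀ T : ℝ)
      ≤ 2 + (Real.log (max (G * D) 1) + 2 * Real.log T) / Real.log 2 := by
  have hl2 : 0 < Real.log 2 := Real.log_pos one_lt_two
  have hT0 : (0 : ℝ) < T := by exact_mod_cast hT
  have hlT : 0 ≤ Real.log T := Real.log_nonneg (by exact_mod_cast hT)
  have hlB : 0 ≤ Real.log (max (G * D) 1) := Real.log_nonneg (le_max_right _ _)
  rcases Nat.lt_or_ge (jumpCount f S x₀ T) 2 with hlt | hge
  · have : (jumpCount f S x₀ T : ℝ) ≤ 2 := by exact_mod_cast hlt.le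
    have : 0 ≤ (Real.log (max (G * D) 1) + 2 * Real.log T) / Real.log 2 := by positivity
    linarith
  obtain ⟨k, hk⟩ := Nat.exists_eq_add_of_le' hge
  obtain ⟨h0, -⟩ | ⟨s, hsT, hs, hc, -⟩ := exists_last_jump f S x₀ T
  · omega
  have h1 := (h.two_pow_mul_le_lazyGap k hs hsT (hc.trans hk)).trans
    ((h.lazyGap_le hs.1 hsT).trans (le_max_left _ 1))
  rw [mul_one_div, div_le_iff₀ (by positivity)] at h1
  have h2 := Real.log_le_log (by positivity) h1
  rw [Real.log_mul (by positivity) (by positivity), Real.log_pow, Real.log_pow] at h2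
  rw [hk]
  push_cast at h2 ⊢
  rw [add_comm, add_le_add_iff_left, le_div_iff₀ hl2]
  exact h2

/-! ### Movement phase by phase -/

/-- While no jump occurs, Gap-Frugal moves along a self-contracted sequence. -/
theorem IsAdmissible.isSelfContracted (h : IsAdmissible X f S x₀ T D G) {s n : ℕ}
    (hn : s + n ≤ T) (hno : ∀ i, s < i → i ≤ s + n → ¬ IsJump f S x₀ i) :
    IsSelfContracted (fun i => gapFrugal f S x₀ (s + i)) n := by
  intro i j k hij hjk hkn
  induction j, hij using Nat.le_induction with
  | base => exact le_rfl
  | succ j hij ih =>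
    refine le_trans ?_ (ih (Nat.le_of_succ_le hjk))
    have h1 := gapFrugal_eq_of_not_isJump (by omega) (hno (s + (j + 1)) (by omega) (by omega))
    dsimp only
    rw [h1]
    -- Projecting onto a convex set brings the action no farther from any point of that set, and by
    -- nestedness the later action lies in it.
    exact (h.isNearest_proj (by omega) (by omega) _).norm_sub_le
      (h.input.convex _ (by omega) (by omega))
      (h.subset_of_le (by omega) (by omega) (by omega) (h.gapFrugal_mem (by omega) (by omega)))

theorem movementCost_add (x : ℕ → E d) (s n : ℕ) : movementCost x (s + n)
    = movementCost x s + ∑ i ∈ Finset.range n, ‖x (s + (i + 1)) - x (s + i)‖ := by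
  induction n with
  | zero => simp
  | succ n ih =>
    rw [Finset.sum_range_succ, ← add_assoc (movementCost x s), ← ih, ← add_assoc]
    unfold movementCost
    rw [Finset.sum_Icc_succ_top (Nat.le_add_left 1 (s + n)), Nat.add_sub_cancel, add_assoc]

/-- Cutting at the last jump: the jump itself costs at most `D`, the jump-free phase after it at
most `L * D`. -/
theorem IsAdmissible.movementCost_le (h : IsAdmissible X f S x₀ T D G) {L : ℝ}
    (hL : ∀ (x : ℕ → E d) (n : ℕ) (D : ℝ), IsSelfContracted x n →
      (∀ i j, i ≤ n → j ≤ n → ‖x i - x j‖ ≤ D) →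
        ∑ i ∈ Finset.range n, ‖x (i + 1) - x i‖ ≤ L * D) {t : ℕ} (htT : t ≤ T) :
    movementCost (gapFrugal f S x₀) t
      ≤ (jumpCount f S x₀ t + 1) * (L * D) + jumpCount f S x₀ t * D := by
  have hphase (s n : ℕ) (hn : s + n ≤ T) (hno : ∀ i, s < i → i ≤ s + n → ¬ IsJump f S x₀ i) :
      movementCost (gapFrugal f S x₀) (s + n)
        ≤ movementCost (gapFrugal f S x₀) s + L * D := by
    rw [movementCost_add]
    exact add_le_add_right (hL _ n D (h.isSelfContracted hn hno) fun i j hi hj =>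
      h.norm_sub_le (h.gapFrugal_mem_domain (by omega)) (h.gapFrugal_mem_domain (by omega))) _
  induction t using Nat.strong_induction_on with
  | _ t ih =>
  obtain ⟨h0, hno⟩ | ⟨s, hst, hs, hc, hno⟩ := exists_last_jump f S x₀ t
  · have h1 := hphase 0 t (by omega) fun i _ hi => hno i (by omega)
    rw [h0, zero_add] at *
    have h2 : movementCost (gapFrugal f S x₀) 0 = 0 := by simp [movementCost]
    simpa [h2] using h1
  · obtain ⟨k, rfl⟩ := Nat.exists_eq_add_of_le hst
    obtain ⟨s, rfl⟩ := Nat.exists_eq_add_of_le' hs.1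
    rw [← hc, jumpCount_succ_of_isJump hs]
    have h1 := hphase (s + 1) k htT hno
    have h2 := ih s (by omega) (by omega)
    have h3 := movementCost_add (gapFrugal f S x₀) s 1
    rw [Finset.sum_range_one] at h3
    have h4 := h.norm_sub_le (h.gapFrugal_mem_domain (t := s + 1) (by omega))
      (h.gapFrugal_mem_domain (t := s) (by omega))
    simp only [zero_add, add_zero] at h3
    push_cast
    linarith

end

end Cones

theorem mainTheorem6 :
    ∃ C : ℝ, ∀ (d : ℕ) (D : ℝ) (G : NNReal), ∃ K : ℝ,
      ∀ (X : Set (Cones.E d)) (f : Cones.E d → ℝ) (S : ℕ → Set (Cones.E d)) (x₀ : Cones.E d)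
        (T : ℕ),
        IsCompact X → Convex ℝ X → Metric.diam X ≤ D →
        ConvexOn ℝ X f → LipschitzOnWith G f X →
        x₀ ∈ X → 1 ≤ T → Cones.IsNestedInput X S T → Cones.IsDirectional f S T →
          Cones.regret f S (Cones.gapFrugal f S x₀) T ≤ C ∧
          (2 ≤ T → Cones.movementCost (Cones.gapFrugal f S x₀) T ≤ K * Real.log T ^ 2) := by
  refine ⟨2, fun d D G => ?_⟩
  obtain ⟨L, hL0, hL⟩ := Cones.exists_length_bound_of_isSelfContracted d
  set l := Real.log 2 with hl
  set b := Real.log (max (G * D) 1) with hb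
  have hl0 : 0 < l := Real.log_pos one_lt_two
  have hb0 : 0 ≤ b := Real.log_nonneg (le_max_right _ _)
  refine ⟨(5 + b / l) * ((L + 1) * D) / l ^ 2, ?_⟩
  intro X f S x₀ T hX _ hdiam _ hf hx₀ hT hS hdir
  have h : Cones.IsAdmissible X f S x₀ T D G := ⟨hX, hdiam, hf, hx₀, hS, hdir⟩
  refine ⟨h.regret_le hT, fun hT2 => ?_⟩
  have hD := h.diam_nonneg
  have h1 := h.movementCost_le hL le_rfl
  have h2 := h.jumpCount_le hT
  have hlT : l ≤ Real.log T := Real.log_le_log two_pos (by exact_mod_cast hT2)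
  generalize (Cones.jumpCount f S x₀ T : ℝ) = m at h1 h2
  set q := Real.log T / l with hq
  have hq1 : 1 ≤ q := (one_le_div hl0).2 hlT
  -- From `m ≤ 2 + b / l + 2 * q`, the constants being absorbed using `q ≥ 1`.
  have hm : m + 1 ≤ (5 + b / l) * q := by
    have h3 : (b + 2 * Real.log T) / l = b / l + 2 * q := by rw [hq]; ring
    have h4 : 0 ≤ b / l := by positivity
    rw [h3] at h2
    nlinarith
  have hLD : 0 ≤ L * D := by positivity
  calc Cones.movementCost (Cones.gapFrugal f S x₀) T
      ≤ (m + 1) * ((L + 1) * D) := by linarith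
    _ ≤ (5 + b / l) * q * ((L + 1) * D) := by gcongr
    -- The bound so far is linear in `log T`; squaring `q ≥ 1` only relaxes it to the stated form.
    _ ≤ (5 + b / l) * q ^ 2 * ((L + 1) * D) := by
        gcongr
        exact le_self_pow₀ hq1 two_ne_zero
    _ = (5 + b / l) * ((L + 1) * D) / l ^ 2 * Real.log T ^ 2 := by rw [hq]; field_simp
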